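/- Let $f\in\mathbb{C}[x,y]$ be a polynomial, let $f_x,f_y$ be its partial derivatives, and let $h,h_1,h_2\in S=\mathbb{C}[x_0,x_1,x_2]$ be the homogenizations of $f,f_x,f_y$ with respect to $x_0$ (with $x_1=x$, $x_2=y$; the homogenization of $p$ is $x_0^{\deg p}\,p(x_1/x_0,x_2/x_0)$, and that of $0$ is $0$). Let $J=(h,h_1,h_2)\subset S$ and $S_+=(x_0,x_1,x_2)$. (1) If $f$ is square-free and the affine curve $\{f=0\}\subset\mathbb{C}^2$ is not smooth, i.e. $f,f_x,f_y$ have a common zero in $\mathbb{C}^2$, then $\dim S/J=1$. (2) Whenever $\dim S/J=1$, the following are equivalent: (a) the graded ring $S/J$ is Cohen–Macaulay; (b) $J$ is unmixed, i.e. all associated primes of $J$ have the same height; (c) $S_+$ is not an embedded prime of $J$, i.e. $S_+$ is not an associated prime of $S/J$ that is non-minimal over $J$. Here a Noetherian ring $A$ is Cohen–Macaulay if $\operatorname{depth}A_{\mathfrak m}=\dim A_{\mathfrak m}$ for every maximal ideal $\mathfrak m$, where depth is the supremum of the lengths of regular sequences in the maximal ideal. -/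

import Mathlib

open MvPolynomial

noncomputable section

namespace PlaneCurve

/-- The depth of a local ring: the supremum of the lengths of the regular sequences
contained in its maximal ideal. -/
def depth (R : Type*) [CommRing R] [IsLocalRing R] : ℕ∞ :=
  ⨆ rs : {rs : List R // RingTheory.Sequence.IsRegular R rs ∧
    ∀ r ∈ rs, r ∈ IsLocalRing.maximalIdeal R}, (rs.1.length : ℕ∞)

/-- A Noetherian local ring is Cohen–Macaulay if its depth equals its Krull dimension. -/
def IsCohenMacaulayLocalRing (R : Type*) [CommRing R] [IsLocalRing R] : Prop :=
  IsNoetherianRing R ∧ (depth R : WithBot ℕ∞) = ringKrullDim R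

/-- A Noetherian ring is Cohen–Macaulay if all its localizations at maximal ideals are
Cohen–Macaulay local rings. -/
def IsCohenMacaulayRing (R : Type*) [CommRing R] : Prop :=
  IsNoetherianRing R ∧
    ∀ (m : Ideal R) [m.IsMaximal], IsCohenMacaulayLocalRing (Localization.AtPrime m)

/-- `P` is an embedded prime of `I`: an associated prime of `R ⧸ I` which is not minimal
over `I`. -/
def IsEmbeddedPrime {R : Type*} [CommRing R] (I P : Ideal R) : Prop :=
  P ∈ associatedPrimes R (R ⧸ I) ∧ P ∉ I.minimalPrimes

/-- An ideal is unmixed if all its associated primes have the same height. -/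
def IsUnmixed {R : Type*} [CommRing R] (I : Ideal R) : Prop :=
  ∀ P ∈ associatedPrimes R (R ⧸ I), ∀ Q ∈ associatedPrimes R (R ⧸ I), P.height = Q.height

/-- The homogenization of a polynomial `p` in `n` variables with respect to a new variable,
which gets the index `0`: each monomial `x ^ m` of `p` is multiplied by the power
`x₀ ^ (deg p - |m|)`. -/
def homogenization {n : ℕ} (p : MvPolynomial (Fin n) ℂ) : MvPolynomial (Fin (n + 1)) ℂ :=
  ∑ m ∈ p.support, monomial (Finsupp.cons (p.totalDegree - m.degree) m) (p.coeff m)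

/-- The ideal of `ℂ[x₀, x₁, x₂]` generated by the homogenizations of `f` and of its two
partial derivatives. -/
def jacobianIdeal (f : MvPolynomial (Fin 2) ℂ) : Ideal (MvPolynomial (Fin 3) ℂ) :=
  Ideal.span {homogenization f, homogenization (pderiv 0 f), homogenization (pderiv 1 f)}

/-- The ideal generated by `x₀, x₁, x₂`. -/
def irrelevantIdeal : Ideal (MvPolynomial (Fin 3) ℂ) :=
  Ideal.span {X 0, X 1, X 2}

/-- The set of singular points of the affine plane curve `f = 0`. -/
def singularPoints (f : MvPolynomial (Fin 2) ℂ) : Set (Fin 2 → ℂ) :=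
  {a | eval a f = 0 ∧ eval a (pderiv 0 f) = 0 ∧ eval a (pderiv 1 f) = 0}

end PlaneCurve

end

-- Dimension: a minimal prime `Q` of `J` of height at most 1 would be principal, `Q = (g)`. As `x₀ ∤
-- h`, `Q` omits `x₀`, so setting `x₀ = 1` turns `g` into a non-unit dividing `f`, `f_x` and `f_y`,
-- which square-freeness forbids. Hence minimal primes have height at least 2, and `dim S = 3` gives
-- `dim S/J ≤ 1`. A singular point `a` supplies the zero `(1, a)` of `J`; were the dimension 0, the
-- homogeneous minimal prime vanishing there would be `S₊`, which it cannot be.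
--
-- Equivalences: they hold for any homogeneous `I` with `dim S/I = 1`, each condition amounting to
-- `S₊ ∉ Ass(S/I)` (`isCohenMacaulayRing_quotient_iff`, `isUnmixed_iff`,
-- `isEmbeddedPrime_irrelevantIdeal_iff`). The key fact is that `S₊` is the only maximal ideal that
-- can be associated to `I`, and it is never minimal. Without it every associated prime is minimal
-- of height 2, and prime avoidance puts a nonzerodivisor in each maximal ideal.

attribute [local instance] MvPolynomial.gradedAlgebra

/-! ### Derivatives and homogeneous ideals in polynomial rings -/

namespace MvPolynomial

variable {σ R K : Type*}

lemma IsHomogeneous.eval_smul [CommSemiring R] {p : MvPolynomial σ R} {n : ℕ}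
    (hp : p.IsHomogeneous n) (c : R) (x : σ → R) :
    eval (c • x) p = c ^ n * eval x p := by
  rw [eval_eq, eval_eq, Finset.mul_sum]
  refine Finset.sum_congr rfl fun d hd => ?_
  have hdeg : ∑ i ∈ d.support, d i = n := (hp.degree_eq_sum_deg_support hd).symm
  simp only [Pi.smul_apply, smul_eq_mul, mul_pow, Finset.prod_mul_distrib,
    Finset.prod_pow_eq_pow_sum, hdeg]
  ring

/-- In characteristic zero a polynomial whose partial derivatives all vanish is constant. -/
lemma eq_C_of_forall_pderiv_eq_zero [CommRing R] [IsDomain R] [CharZero R]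
    {p : MvPolynomial σ R} (h : ∀ i, pderiv i p = 0) : p = C (coeff 0 p) := by
  classical
  ext m
  rw [coeff_C]
  split_ifs with hm
  · rw [hm]
  · obtain ⟨i, hi⟩ : ∃ i, m i ≠ 0 := by
      by_contra! h0
      exact hm (Finsupp.ext fun i => (h0 i).symm)
    have hle : Finsupp.single i 1 ≤ m := by
      simpa [Finsupp.single_le_iff] using Nat.one_le_iff_ne_zero.mpr hi
    have hc := congrArg (coeff (m - Finsupp.single i 1)) (h i)
    rw [coeff_pderiv, tsub_add_cancel_of_le hle, coeff_zero] at hc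
    refine (mul_eq_zero.mp hc).resolve_right ?_
    exact Nat.cast_add_one_ne_zero _

lemma totalDegree_pderiv_lt [CommSemiring R] {p : MvPolynomial σ R} {i : σ}
    (h : pderiv i p ≠ 0) : (pderiv i p).totalDegree < p.totalDegree := by
  obtain ⟨m, hm, hdeg⟩ := Finset.exists_mem_eq_sup _ (support_nonempty.mpr h) fun m => m.degree
  change (pderiv i p).totalDegree = m.degree at hdeg
  rw [mem_support_iff, coeff_pderiv] at hm
  have hle := le_totalDegree (mem_support_iff.mpr (left_ne_zero_of_mul hm))
  change (m + Finsupp.single i 1).degree ≤ _ at hle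
  rw [map_add, Finsupp.degree_single] at hle
  omega

/-- An irreducible factor of a square-free polynomial in characteristic zero does not divide all
the partial derivatives. -/
lemma not_forall_dvd_pderiv_of_squarefree [Field K] [CharZero K] {f q : MvPolynomial σ K}
    (hf : Squarefree f) (hq : Irreducible q) (hqf : q ∣ f) : ¬ ∀ i, q ∣ pderiv i f := by
  intro h
  obtain ⟨k, rfl⟩ := hqf
  have hqk : ¬ q ∣ k := fun ⟨l, hl⟩ =>
    hq.not_isUnit (hf q ⟨l, by rw [hl, mul_assoc]⟩)
  -- By the product rule `q` divides `∂ᵢq * k`, hence `∂ᵢq`, whose degree is too small unless it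
  -- vanishes.
  have hz (i) : pderiv i q = 0 := by
    by_contra hne
    have hd : q ∣ pderiv i q * k := by
      have := h i
      rw [pderiv_mul] at this
      exact (dvd_add_left (dvd_mul_right q _)).mp this
    obtain ⟨l, hl⟩ := ((UniqueFactorizationMonoid.irreducible_iff_prime.mp hq).dvd_or_dvd
      hd).resolve_right hqk
    have hlt := totalDegree_pderiv_lt hne
    rw [hl] at hne
    rw [hl, totalDegree_mul_of_isDomain (left_ne_zero_of_mul hne) (right_ne_zero_of_mul hne)]
      at hlt
    omega
  have hC := eq_C_of_forall_pderiv_eq_zero hz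
  refine hq.not_isUnit ?_
  rw [hC]
  refine IsUnit.map C (isUnit_iff_ne_zero.mpr fun h0 => hq.ne_zero ?_)
  rw [hC, h0, C_0]

/-- A homogeneous ideal is stable under the scaling action on its zero locus. -/
lemma smul_mem_zeroLocus [Field K] {I : Ideal (MvPolynomial σ K)}
    (hI : I.IsHomogeneous (homogeneousSubmodule σ K)) {x : σ → K} (hx : x ∈ zeroLocus K I)
    (c : K) : c • x ∈ zeroLocus K I := by
  intro p hp
  change eval (c • x) p = 0
  rw [← sum_homogeneousComponent p, map_sum]
  refine Finset.sum_eq_zero fun n _ => ?_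
  rw [(homogeneousComponent_isHomogeneous n p).eval_smul]
  have hn : eval x (homogeneousComponent n p) = 0 := hx _ (homogeneousComponent_mem_of_mem hI hp n)
  rw [hn, mul_zero]

lemma le_ker_constantCoeff_of_isHomogeneous [Field K] {I : Ideal (MvPolynomial σ K)}
    (hI : I.IsHomogeneous (homogeneousSubmodule σ K)) (hne : I ≠ ⊤) :
    I ≤ RingHom.ker (constantCoeff : MvPolynomial σ K →+* K) := by
  intro p hp
  rw [RingHom.mem_ker, constantCoeff_eq]
  by_contra hc
  have h0 := homogeneousComponent_mem_of_mem hI hp 0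
  rw [homogeneousComponent_zero] at h0
  exact hne (Ideal.eq_top_of_isUnit_mem _ h0 (IsUnit.map C (isUnit_iff_ne_zero.mpr hc)))

lemma homogeneousComponent_succ_X_mul [CommSemiring R] (i : σ) (p : MvPolynomial σ R) (n : ℕ) :
    homogeneousComponent (n + 1) (X i * p) = X i * homogeneousComponent n p := by
  classical
  ext d
  rw [coeff_homogeneousComponent, coeff_X_mul', coeff_X_mul', coeff_homogeneousComponent]
  by_cases hi : i ∈ d.support
  · have hle : Finsupp.single i 1 ≤ d := by
      simpa [Finsupp.single_le_iff] using Nat.one_le_iff_ne_zero.mpr (Finsupp.mem_support_iff.mp hi)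
    have hd : (d - Finsupp.single i 1).degree + 1 = d.degree := by
      conv_rhs => rw [← tsub_add_cancel_of_le hle, map_add, Finsupp.degree_single]
    simp only [hi, if_true, ← hd, add_left_inj]
  · simp [hi]

/-- Modulo a homogeneous ideal, `Xᵢ - a` with `a ≠ 0` is not a zero divisor. -/
lemma mem_of_X_sub_C_mul_mem [Field K] {I : Ideal (MvPolynomial σ K)}
    (hI : I.IsHomogeneous (homogeneousSubmodule σ K)) {i : σ} {a : K} (ha : a ≠ 0)
    {p : MvPolynomial σ K} (h : (X i - C a) * p ∈ I) : p ∈ I := by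
  have hunit : IsUnit (C a : MvPolynomial σ K) := IsUnit.map C (isUnit_iff_ne_zero.mpr ha)
  have hcomp (n) := homogeneousComponent_mem_of_mem hI h n
  simp only [sub_mul, map_sub, homogeneousComponent_C_mul] at hcomp
  rw [mem_iff_homogeneousComponent_mem hI]
  intro n
  -- In degree `n + 1` the product has component `Xᵢ pₙ - a pₙ₊₁`, so membership of `pₙ` passes to
  -- `pₙ₊₁`.
  induction n with
  | zero =>
    have h0 := hcomp 0
    rw [homogeneousComponent_zero, ← constantCoeff_eq, map_mul,
      constantCoeff_X, zero_mul, C_0, zero_sub, neg_mem_iff] at h0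
    exact (Ideal.unit_mul_mem_iff_mem I hunit).mp h0
  | succ n ih =>
    have h1 := hcomp (n + 1)
    rw [homogeneousComponent_succ_X_mul, I.sub_mem_iff_right (I.mul_mem_left _ ih)] at h1
    exact (Ideal.unit_mul_mem_iff_mem I hunit).mp h1

end MvPolynomial

/-- The homogeneous core of `P` is prime and still contains `I`, so minimality makes it all of `P`.
-/
lemma Ideal.IsHomogeneous.of_mem_minimalPrimes {ι A σ : Type*} [CommRing A] [SetLike σ A]
    [AddSubgroupClass σ A] [AddCommMonoid ι] [LinearOrder ι] [IsOrderedCancelAddMonoid ι]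
    {𝒜 : ι → σ} [GradedRing 𝒜] {I P : Ideal A} (hI : I.IsHomogeneous 𝒜)
    (hP : P ∈ I.minimalPrimes) : P.IsHomogeneous 𝒜 := by
  have hprime : P.IsPrime := hP.1.1
  rw [Ideal.IsHomogeneous.iff_eq]
  refine le_antisymm (Ideal.toIdeal_homogeneousCore_le 𝒜 P) (hP.2 ⟨hprime.homogeneousCore, ?_⟩
    (Ideal.toIdeal_homogeneousCore_le 𝒜 P))
  conv_lhs => rw [← hI.toIdeal_homogeneousCore_eq_self]
  exact Ideal.homogeneousCore_mono 𝒜 hP.1.2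

/-! ### Homogenization -/

namespace PlaneCurve

variable {n : ℕ}

lemma degree_cons (k : ℕ) (m : Fin n →₀ ℕ) : (Finsupp.cons k m).degree = k + m.degree := by
  simp [Finsupp.degree_eq_sum, Fin.sum_univ_succ]

lemma isHomogeneous_homogenization (p : MvPolynomial (Fin n) ℂ) :
    (homogenization p).IsHomogeneous p.totalDegree := by
  refine IsHomogeneous.sum _ _ _ fun m hm => isHomogeneous_monomial _ ?_
  have : m.degree ≤ p.totalDegree := le_totalDegree hm
  rw [degree_cons]
  omega

/-- Substituting `1` for `x₀` in the homogenization gives back the polynomial. -/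
lemma aeval_cons_one_homogenization (p : MvPolynomial (Fin n) ℂ) :
    aeval (Fin.cons 1 X : Fin (n + 1) → MvPolynomial (Fin n) ℂ) (homogenization p) = p := by
  conv_rhs => rw [p.as_sum]
  rw [homogenization, map_sum]
  refine Finset.sum_congr rfl fun m _ => ?_
  rw [aeval_monomial, monomial_eq, Finsupp.prod_fintype _ _ (by simp),
    Finsupp.prod_fintype _ _ (by simp), Fin.prod_univ_succ]
  simp

lemma eval_cons_one_homogenization (p : MvPolynomial (Fin n) ℂ) (a : Fin n → ℂ) :
    eval (Fin.cons 1 a) (homogenization p) = eval a p := by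
  have hcomp : (aeval a).comp (aeval (Fin.cons 1 X : Fin (n + 1) → MvPolynomial (Fin n) ℂ)) =
      aeval (Fin.cons 1 a : Fin (n + 1) → ℂ) := by
    ext i
    refine Fin.cases ?_ (fun i => ?_) i <;> simp
  have h := DFunLike.congr_fun hcomp (homogenization p)
  rw [AlgHom.comp_apply, aeval_cons_one_homogenization] at h
  exact h.symm

lemma homogenization_eq_zero_iff {p : MvPolynomial (Fin n) ℂ} : homogenization p = 0 ↔ p = 0 := by
  refine ⟨fun h => ?_, fun h => by simp [h, homogenization]⟩
  rw [← aeval_cons_one_homogenization p, h, map_zero]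

/-- A monomial of top degree receives exponent 0 in `x₀`. -/
lemma not_X_zero_dvd_homogenization {p : MvPolynomial (Fin n) ℂ} (hp : p ≠ 0) :
    ¬ X 0 ∣ homogenization p := by
  rintro ⟨k, hk⟩
  obtain ⟨m, hm, hdeg⟩ := Finset.exists_mem_eq_sup p.support (support_nonempty.mpr hp)
    (fun m => m.degree)
  have hdeg' : p.totalDegree = m.degree := hdeg
  have h0 := congrArg (coeff (Finsupp.cons 0 m)) hk
  rw [coeff_X_mul', if_neg (by simp), homogenization, coeff_sum,
    Finset.sum_eq_single_of_mem m hm] at h0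
  · rw [hdeg', Nat.sub_self, coeff_monomial, if_pos rfl] at h0
    exact mem_support_iff.mp hm h0
  · intro m' _ hne
    rw [coeff_monomial, if_neg]
    exact fun h => hne (Finsupp.cons_injective2 h).2

end PlaneCurve

/-- The primes over `I` are minimal over `I` or maximal exactly if `R ⧸ I` has Krull dimension
at most one. -/
lemma Ideal.krullDimLE_one_quotient_iff {R : Type*} [CommRing R] {I : Ideal R} :
    Ring.KrullDimLE 1 (R ⧸ I) ↔
      ∀ P : Ideal R, P.IsPrime → I ≤ P → P ∈ I.minimalPrimes ∨ P.IsMaximal := by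
  have hsurj : Function.Surjective (Ideal.Quotient.mk I) := Ideal.Quotient.mk_surjective
  rw [Ring.krullDimLE_one_iff, Ideal.minimalPrimes_eq_comap]
  constructor
  · intro h P hP hIP
    have hP' := Ideal.isPrime_map_quotientMk_of_isPrime hIP
    have hcm := Ideal.comap_map_mk hIP
    refine (h _ hP').imp (fun hmin => ⟨_, hmin, hcm⟩) fun hmax => ?_
    have := hmax
    rw [← hcm]
    exact Ideal.comap_isMaximal_of_surjective _ hsurj
  · intro h Q hQ
    have hIQ : I ≤ Q.comap (Ideal.Quotient.mk I) := by
      conv_lhs => rw [← Ideal.mk_ker (I := I)]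
      exact Ideal.comap_mono bot_le
    refine (h _ (Ideal.comap_isPrime _ _) hIQ).imp ?_ fun hmax => ?_
    · rintro ⟨Q', hQ', he⟩
      rwa [← Ideal.comap_injective_of_surjective _ hsurj he]
    · have := Ideal.map_eq_top_or_isMaximal_of_surjective _ hsurj hmax
      rw [Ideal.map_comap_of_surjective _ hsurj] at this
      exact this.resolve_left hQ.ne_top

lemma Ideal.mem_associatedPrimes_quotient_iff {R : Type*} [CommRing R] [IsNoetherianRing R]
    {I P : Ideal R} :
    P ∈ associatedPrimes R (R ⧸ I) ↔ P.IsPrime ∧ ∃ x, ∀ a, a ∈ P ↔ a * x ∈ I := by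
  rw [AssociatedPrimes.mem_iff, isAssociatedPrime_iff, Ideal.Quotient.mk_surjective.exists]
  simp only [SetLike.ext_iff, Submodule.mem_colon_singleton, Submodule.mem_bot,
    Algebra.smul_def, Ideal.Quotient.algebraMap_eq, ← map_mul, Ideal.Quotient.eq_zero_iff_mem]

namespace PlaneCurve

/-! ### Depth of local rings -/

section Depth

lemma depth_le_ringKrullDim (R : Type*) [CommRing R] [IsLocalRing R] [IsNoetherianRing R] :
    (depth R : WithBot ℕ∞) ≤ ringKrullDim R := by
  obtain ⟨k, hk⟩ := WithBot.ne_bot_iff_exists.mp (ringKrullDim_ne_bot (R := R))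
  rw [← hk, WithBot.coe_le_coe, depth, iSup_le_iff]
  rintro ⟨rs, hreg, hmem⟩
  rw [← WithBot.coe_le_coe, hk, ← ringKrullDim_add_length_eq_ringKrullDim_of_isRegular rs hreg]
  have hne : Ideal.ofList rs ≠ ⊤ :=
    ne_top_of_le_ne_top (IsLocalRing.maximalIdeal.isMaximal R).ne_top (Ideal.span_le.mpr hmem)
  have : Nontrivial (R ⧸ Ideal.ofList rs) := Ideal.Quotient.nontrivial_iff.mpr hne
  exact le_add_of_nonneg_left ringKrullDim_nonneg_of_nontrivial

variable {A : Type*} [CommRing A]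

lemma one_le_depth_localization [IsNoetherianRing A] {m : Ideal A} [m.IsPrime] {s : A}
    (hsm : s ∈ m) (hs : s ∈ nonZeroDivisors A) : 1 ≤ depth (Localization.AtPrime m) := by
  have hmem : algebraMap A (Localization.AtPrime m) s ∈ IsLocalRing.maximalIdeal _ :=
    (IsLocalization.AtPrime.to_map_mem_maximal_iff _ m s).mpr hsm
  have hs' : algebraMap A (Localization.AtPrime m) s ∈
      nonZeroDivisors (Localization.AtPrime m) :=
    IsLocalization.map_nonZeroDivisors_le m.primeCompl _ (Submonoid.mem_map_of_mem _ hs)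
  have hmem' : ∀ r ∈ [algebraMap A (Localization.AtPrime m) s],
      r ∈ IsLocalRing.maximalIdeal (Localization.AtPrime m) := by
    simpa using hmem
  have hreg : RingTheory.Sequence.IsRegular (Localization.AtPrime m)
      [algebraMap A (Localization.AtPrime m) s] := by
    refine .of_isWeaklyRegular_of_mem_maximalIdeal _ hmem' ?_
    rw [RingTheory.Sequence.isWeaklyRegular_singleton_iff, isSMulRegular_iff_right_eq_zero_of_smul]
    exact fun x hx => (mem_nonZeroDivisors_iff_right.mp hs') x (by rwa [mul_comm])
  exact le_iSup_of_le (ι := {rs : List (Localization.AtPrime m) //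
    RingTheory.Sequence.IsRegular _ rs ∧ ∀ r ∈ rs, r ∈ IsLocalRing.maximalIdeal _})
    ⟨_, hreg, hmem'⟩ (by simp)

/-- The image of `x` is nonzero in the localization but killed by the whole maximal ideal, so no
regular sequence can start. -/
lemma depth_localization_eq_zero {m : Ideal A} [m.IsPrime] {x : A}
    (hx : ∀ a, a * x = 0 ↔ a ∈ m) : depth (Localization.AtPrime m) = 0 := by
  rw [depth, ENat.iSup_eq_zero]
  rintro ⟨rs, hreg, hmem⟩
  cases rs with
  | nil => simp
  | cons r rs =>
    exfalso
    have hr := ((RingTheory.Sequence.isRegular_cons_iff _ _ _).mp hreg).1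
    obtain ⟨a, s, rfl⟩ := IsLocalization.exists_mk'_eq m.primeCompl r
    have ha : a ∈ m := (IsLocalization.AtPrime.mk'_mem_maximal_iff _ m a s).mp
      (hmem _ List.mem_cons_self)
    have h0 : IsLocalization.mk' (Localization.AtPrime m) a s •
        algebraMap A (Localization.AtPrime m) x = 0 := by
      rw [smul_eq_mul, IsLocalization.mk'_eq_mul_mk'_one, mul_right_comm, ← map_mul, (hx a).mpr ha,
        map_zero, zero_mul]
    have hx0 := (isSMulRegular_iff_right_eq_zero_of_smul.mp hr) _ h0
    obtain ⟨t, ht⟩ := (IsLocalization.map_eq_zero_iff m.primeCompl _ x).mp hx0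
    exact t.2 ((hx t).mp ht)

end Depth

/-! ### The irrelevant ideal and heights -/

lemma irrelevantIdeal_eq_ker : irrelevantIdeal = RingHom.ker (constantCoeff : _ →+* ℂ) := by
  refine le_antisymm (Ideal.span_le.mpr ?_) fun p hp => ?_
  · rintro _ (rfl | rfl | rfl) <;> simp [RingHom.mem_ker]
  · have hset : ({X 0, X 1, X 2} : Set (MvPolynomial (Fin 3) ℂ)) = X '' Set.univ := by
      ext q
      simp [Fin.exists_fin_succ, eq_comm]
    rw [irrelevantIdeal, hset, mem_ideal_span_X_image]
    intro m hm
    by_contra! h0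
    have : m = 0 := Finsupp.ext fun i => h0 i (Set.mem_univ i)
    rw [this, mem_support_iff] at hm
    exact hm hp

instance isMaximal_irrelevantIdeal : irrelevantIdeal.IsMaximal := by
  rw [irrelevantIdeal_eq_ker]
  exact RingHom.ker_isMaximal_of_surjective _ fun c => ⟨C c, constantCoeff_C _ c⟩

lemma ringKrullDim_mvPolynomial_fin_three : ringKrullDim (MvPolynomial (Fin 3) ℂ) = 3 := by
  rw [MvPolynomial.ringKrullDim_of_isNoetherianRing, ringKrullDim_eq_zero_of_field]
  simp

lemma height_irrelevantIdeal : irrelevantIdeal.height = 3 := by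
  refine le_antisymm ?_ ?_
  · rw [← WithBot.coe_le_coe]
    exact (Ideal.height_le_ringKrullDim_of_ne_top Ideal.IsPrime.ne_top').trans_eq
      ringKrullDim_mvPolynomial_fin_three
  -- Kernels of substitutions are prime; killing one variable at a time gives a chain of length 3.
  · let P (v : Fin 3 → MvPolynomial (Fin 3) ℂ) : Ideal (MvPolynomial (Fin 3) ℂ) :=
      RingHom.ker (aeval v)
    have hP (v) : (P v).IsPrime := RingHom.ker_isPrime _
    have hle {v w : Fin 3 → MvPolynomial (Fin 3) ℂ} (h : ∀ i, aeval w (v i) = w i) :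
        P v ≤ P w := by
      intro p hp
      have hc : (aeval w).comp (aeval v) = (aeval w : MvPolynomial (Fin 3) ℂ →ₐ[ℂ] _) := by
        refine algHom_ext fun i => ?_
        rw [AlgHom.comp_apply, aeval_X, aeval_X, h]
      have hp0 : aeval v p = 0 := hp
      change aeval w p = 0
      rw [← hc, AlgHom.comp_apply, hp0, map_zero]
    have hlt {v w : Fin 3 → MvPolynomial (Fin 3) ℂ} (h : ∀ i, aeval w (v i) = w i) (i : Fin 3)
        (hv : v i ≠ 0) (hw : w i = 0) : (P v).height + 1 ≤ (P w).height := by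
      refine Ideal.height_add_one_le_of_lt_of_isPrime ((hle h).lt_of_not_ge fun hge => hv ?_)
      have : X i ∈ P w := by simp [P, RingHom.mem_ker, hw]
      simpa [P, RingHom.mem_ker] using hge this
    have h1 := hlt (v := ![X 0, X 1, X 2]) (w := ![0, X 1, X 2])
      (by intro i; fin_cases i <;> simp) 0 (by simp) (by simp)
    have h2 := hlt (v := ![0, X 1, X 2]) (w := ![0, 0, X 2])
      (by intro i; fin_cases i <;> simp) 1 (by simp) (by simp)
    have h3 := hlt (v := ![0, 0, X 2]) (w := ![0, 0, 0])
      (by intro i; fin_cases i <;> simp) 2 (by simp) (by simp)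
    have hI : P ![0, 0, 0] ≤ irrelevantIdeal := by
      have h0 : (![0, 0, 0] : Fin 3 → MvPolynomial (Fin 3) ℂ) = 0 := by
        ext i; fin_cases i <;> simp
      rw [irrelevantIdeal_eq_ker, h0]
      intro p hp
      have hp0 : aeval (0 : Fin 3 → MvPolynomial (Fin 3) ℂ) p = 0 := hp
      rw [aeval_zero] at hp0
      simpa [RingHom.mem_ker] using hp0
    calc (3 : ℕ∞) = 0 + 1 + 1 + 1 := by norm_num
      _ ≤ (P ![X 0, X 1, X 2]).height + 1 + 1 + 1 := by gcongr; exact zero_le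
      _ ≤ (P ![0, 0, 0]).height := by
        refine le_trans ?_ h3
        gcongr
        refine le_trans ?_ h2
        gcongr
      _ ≤ _ := Ideal.height_mono hI

/-- A prime properly contained in the irrelevant ideal, with quotient of dimension at most one,
has height two. -/
lemma height_eq_two {P : Ideal (MvPolynomial (Fin 3) ℂ)} [P.IsPrime] (hlt : P < irrelevantIdeal)
    (hdim : ringKrullDim (MvPolynomial (Fin 3) ℂ ⧸ P) ≤ 1) : P.height = 2 := by
  -- Dividing by one element lowers height by at most 1, so a principal `P` would force `3 ≤ 1 + 1`.
  -- This excludes heights 0 and 1.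
  have hnp (g) : P ≠ Ideal.span {g} := by
    rintro rfl
    have h := Ideal.height_le_ringKrullDim_quotient_add_one (r := g) (p := irrelevantIdeal)
      (hlt.le (Ideal.mem_span_singleton_self g))
    rw [height_irrelevantIdeal] at h
    have h' := h.trans (add_le_add_left hdim 1)
    exact absurd h' (by decide)
  have h2 : P.height + 1 ≤ 3 := by
    rw [← height_irrelevantIdeal]
    exact Ideal.height_add_one_le_of_lt_of_isPrime hlt
  have h0 : P.height ≠ 0 := by
    rw [Ne, Ideal.height_eq_zero_iff_eq_bot]
    rintro rfl
    exact hnp 0 (by simp)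
  have h1 : P.height ≠ 1 := by
    intro h
    obtain ⟨g, hg, hgp⟩ := Ideal.IsPrime.exists_mem_prime_of_ne_bot ‹P.IsPrime›
      (Ideal.ne_bot_of_height_eq_one h)
    exact hnp g (Ideal.eq_span_singleton_of_height_eq_one h hg hgp)
  lift P.height to ℕ using Ideal.height_ne_top_of_isPrime with k
  norm_cast at *
  omega

/-! ### Associated primes of homogeneous ideals of dimension one -/

section Homogeneous

variable {I : Ideal (MvPolynomial (Fin 3) ℂ)}

lemma le_irrelevantIdeal (hI : I.IsHomogeneous (homogeneousSubmodule (Fin 3) ℂ)) (hne : I ≠ ⊤) :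
    I ≤ irrelevantIdeal := by
  rw [irrelevantIdeal_eq_ker]
  exact le_ker_constantCoeff_of_isHomogeneous hI hne

/-- The only maximal ideal that can be associated to a homogeneous ideal is the irrelevant
ideal. -/
lemma eq_irrelevantIdeal_of_mem_associatedPrimes
    (hI : I.IsHomogeneous (homogeneousSubmodule (Fin 3) ℂ)) {M : Ideal (MvPolynomial (Fin 3) ℂ)}
    (hM : M.IsMaximal) (hass : M ∈ associatedPrimes _ (MvPolynomial (Fin 3) ℂ ⧸ I)) :
    M = irrelevantIdeal := by
  obtain ⟨a, rfl⟩ := isMaximal_iff_eq_vanishingIdeal_singleton.mp hM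
  obtain ⟨-, x, hx⟩ := Ideal.mem_associatedPrimes_quotient_iff.mp hass
  have ha : a = 0 := by
    ext i
    by_contra hi
    -- This element kills `x` modulo `I` yet is a nonzerodivisor there, so `x ∈ I` and `M` would
    -- contain 1.
    have hmem : X i - C (a i) ∈ vanishingIdeal ℂ {a} := by simp
    have hxI := mem_of_X_sub_C_mul_mem hI hi ((hx _).mp hmem)
    exact hM.ne_top ((Ideal.eq_top_iff_one _).mpr ((hx 1).mpr (by rwa [one_mul])))
  rw [irrelevantIdeal_eq_ker, ha]
  ext p
  rw [mem_vanishingIdeal_singleton_iff, RingHom.mem_ker, Pi.zero_def]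
  simp

lemma irrelevantIdeal_notMem_minimalPrimes
    (hI : I.IsHomogeneous (homogeneousSubmodule (Fin 3) ℂ))
    (hdim : ringKrullDim (MvPolynomial (Fin 3) ℂ ⧸ I) = 1) : irrelevantIdeal ∉ I.minimalPrimes := by
  intro hmin
  -- Minimal primes are homogeneous, hence inside `S₊`; if `S₊` is itself minimal it is the only
  -- one.
  have h0 : Ring.KrullDimLE 0 (MvPolynomial (Fin 3) ℂ ⧸ I) := by
    rw [Ideal.krullDimLE_zero_quotient_iff_forall_minimalPrimes_isMaximal]
    intro Q hQ
    have hle := le_irrelevantIdeal (hI.of_mem_minimalPrimes hQ) hQ.1.1.ne_top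
    rw [le_antisymm hle (hmin.2 hQ.1 hle)]
    infer_instance
  rw [Ring.krullDimLE_iff, hdim] at h0
  exact absurd h0 (by decide)

/-- If the irrelevant ideal is not associated to a homogeneous ideal of dimension one, then the
associated primes are minimal and not maximal. -/
lemma mem_minimalPrimes_and_lt_irrelevantIdeal
    (hI : I.IsHomogeneous (homogeneousSubmodule (Fin 3) ℂ))
    (hdim : ringKrullDim (MvPolynomial (Fin 3) ℂ ⧸ I) = 1)
    (hirr : irrelevantIdeal ∉ associatedPrimes _ (MvPolynomial (Fin 3) ℂ ⧸ I))
    {P : Ideal (MvPolynomial (Fin 3) ℂ)}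
    (hP : P ∈ associatedPrimes _ (MvPolynomial (Fin 3) ℂ ⧸ I)) :
    P ∈ I.minimalPrimes ∧ P < irrelevantIdeal := by
  have hprime : P.IsPrime := hP.isPrime
  have hne : P ≠ irrelevantIdeal := fun h => hirr (h ▸ hP)
  have hle : I ≤ P := by
    have := IsAssociatedPrime.annihilator_le hP
    rwa [Submodule.annihilator_top, Ideal.annihilator_quotient] at this
  have hmin := (Ideal.krullDimLE_one_quotient_iff.mp
    (Ring.krullDimLE_iff.mpr hdim.le) P hprime hle).resolve_right
      fun hM => hne (eq_irrelevantIdeal_of_mem_associatedPrimes hI hM hP)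
  exact ⟨hmin, lt_of_le_of_ne
    (le_irrelevantIdeal (hI.of_mem_minimalPrimes hmin) hprime.ne_top) hne⟩

theorem isEmbeddedPrime_irrelevantIdeal_iff
    (hI : I.IsHomogeneous (homogeneousSubmodule (Fin 3) ℂ))
    (hdim : ringKrullDim (MvPolynomial (Fin 3) ℂ ⧸ I) = 1) :
    IsEmbeddedPrime I irrelevantIdeal ↔
      irrelevantIdeal ∈ associatedPrimes _ (MvPolynomial (Fin 3) ℂ ⧸ I) :=
  and_iff_left (irrelevantIdeal_notMem_minimalPrimes hI hdim)

lemma ne_top_of_ringKrullDim_quotient_eq_one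
    (hdim : ringKrullDim (MvPolynomial (Fin 3) ℂ ⧸ I) = 1) : I ≠ ⊤ := by
  intro h
  have := Ideal.Quotient.subsingleton_iff.mpr h
  rw [ringKrullDim_eq_bot_of_subsingleton] at hdim
  exact absurd hdim (by decide)

theorem isUnmixed_iff (hI : I.IsHomogeneous (homogeneousSubmodule (Fin 3) ℂ))
    (hdim : ringKrullDim (MvPolynomial (Fin 3) ℂ ⧸ I) = 1) :
    IsUnmixed I ↔ irrelevantIdeal ∉ associatedPrimes _ (MvPolynomial (Fin 3) ℂ ⧸ I) := by
  constructor
  · intro h hirr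
    obtain ⟨Q, hQ, hle⟩ := Ideal.exists_minimalPrimes_le
      (le_irrelevantIdeal hI (ne_top_of_ringKrullDim_quotient_eq_one hdim))
    have hQass : Q ∈ associatedPrimes _ (MvPolynomial (Fin 3) ℂ ⧸ I) := by
      refine Module.associatedPrimes.minimalPrimes_annihilator_subset_associatedPrimes _ _ ?_
      rwa [Ideal.annihilator_quotient]
    have hprime : Q.IsPrime := hQ.1.1
    have hlt : Q < irrelevantIdeal := lt_of_le_of_ne hle
      fun h => irrelevantIdeal_notMem_minimalPrimes hI hdim (h ▸ hQ)
    exact (Ideal.height_strict_mono_of_isPrime_of_isPrime hlt).ne (h Q hQass _ hirr)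
  · intro hirr
    have h2 {P : Ideal (MvPolynomial (Fin 3) ℂ)}
        (hP : P ∈ associatedPrimes _ (MvPolynomial (Fin 3) ℂ ⧸ I)) : P.height = 2 := by
      have hprime : P.IsPrime := hP.isPrime
      obtain ⟨hmin, hlt⟩ := mem_minimalPrimes_and_lt_irrelevantIdeal hI hdim hirr hP
      refine height_eq_two hlt (le_trans ?_ hdim.le)
      exact ringKrullDim_le_of_surjective (Ideal.Quotient.factor hmin.1.2)
        (Ideal.Quotient.factor_surjective hmin.1.2)
    exact fun P hP Q hQ => (h2 hP).trans (h2 hQ).symm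

theorem isCohenMacaulayRing_quotient_iff
    (hI : I.IsHomogeneous (homogeneousSubmodule (Fin 3) ℂ))
    (hdim : ringKrullDim (MvPolynomial (Fin 3) ℂ ⧸ I) = 1) :
    IsCohenMacaulayRing (MvPolynomial (Fin 3) ℂ ⧸ I) ↔
      irrelevantIdeal ∉ associatedPrimes _ (MvPolynomial (Fin 3) ℂ ⧸ I) := by
  have hsurj : Function.Surjective (Ideal.Quotient.mk I) := Ideal.Quotient.mk_surjective
  constructor
  · rintro ⟨-, hCM⟩ hirr
    obtain ⟨-, x, hx⟩ := Ideal.mem_associatedPrimes_quotient_iff.mp hirr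
    have hle := le_irrelevantIdeal hI (ne_top_of_ringKrullDim_quotient_eq_one hdim)
    have hcm := Ideal.comap_map_mk hle
    set m := irrelevantIdeal.map (Ideal.Quotient.mk I) with hm
    have hprime : m.IsPrime := Ideal.isPrime_map_quotientMk_of_isPrime hle
    have hmax : m.IsMaximal := (Ideal.map_eq_top_or_isMaximal_of_surjective _ hsurj
      inferInstance).resolve_left hprime.ne_top
    have hdepth : depth (Localization.AtPrime m) = 0 := by
      refine depth_localization_eq_zero (x := Ideal.Quotient.mk I x) fun a => ?_
      obtain ⟨a, rfl⟩ := hsurj a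
      rw [← map_mul, Ideal.Quotient.eq_zero_iff_mem, ← hx, ← Ideal.mem_comap, hcm]
    have hht := (hCM m).2
    rw [hdepth, IsLocalization.AtPrime.ringKrullDim_eq_height m, WithBot.coe_inj, eq_comm,
      Ideal.height_eq_zero_iff] at hht
    refine irrelevantIdeal_notMem_minimalPrimes hI hdim ?_
    rw [Ideal.minimalPrimes_eq_comap]
    exact ⟨m, hht, hcm⟩
  · intro hirr
    refine ⟨inferInstance, fun m hm => ⟨inferInstance, le_antisymm (depth_le_ringKrullDim _) ?_⟩⟩
    have hM : (m.comap (Ideal.Quotient.mk I)).IsMaximal :=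
      Ideal.comap_isMaximal_of_surjective _ hsurj
    obtain ⟨s, hsm, hs⟩ : ∃ s ∈ m, s ∈ nonZeroDivisors (MvPolynomial (Fin 3) ℂ ⧸ I) := by
      by_contra! hcon
      have hsub : (m.comap (Ideal.Quotient.mk I) : Set (MvPolynomial (Fin 3) ℂ)) ⊆
          ⋃ P ∈ ((associatedPrimes.finite (MvPolynomial (Fin 3) ℂ)
            (MvPolynomial (Fin 3) ℂ ⧸ I)).toFinset : Set (Ideal (MvPolynomial (Fin 3) ℂ))),
            (id P : Ideal (MvPolynomial (Fin 3) ℂ)) := by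
        intro p hp
        simp only [Set.Finite.coe_toFinset, id]
        rw [biUnion_associatedPrimes_eq_zero_divisors]
        have := hcon _ hp
        rw [mem_nonZeroDivisors_iff_right] at this
        push Not at this
        obtain ⟨x, hx, hx0⟩ := this
        exact ⟨x, hx0, by
          rw [← hx, mul_comm]
          exact Algebra.smul_def p x⟩
      -- Prime avoidance; the two `⊥` fill the slots for exceptional, possibly non-prime ideals,
      -- unneeded here.
      obtain ⟨P, hP, hle⟩ := (Ideal.subset_union_prime ⊥ ⊥ fun P hP _ _ =>
        IsAssociatedPrime.isPrime ((Set.Finite.mem_toFinset _).mp hP)).mp hsub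
      have hP' := (Set.Finite.mem_toFinset _).mp hP
      have hlt := (mem_minimalPrimes_and_lt_irrelevantIdeal hI hdim hirr hP').2
      exact Ideal.IsPrime.ne_top' (hM.1.2 _ (hle.trans_lt hlt))
    calc ringKrullDim (Localization.AtPrime m) = m.height :=
          IsLocalization.AtPrime.ringKrullDim_eq_height m (Localization.AtPrime m)
      _ ≤ 1 := (Ideal.height_le_ringKrullDim_of_ne_top Ideal.IsPrime.ne_top').trans hdim.le
      _ ≤ _ := WithBot.coe_le_coe.mpr (one_le_depth_localization hsm hs)

end Homogeneous

/-! ### Dimension of the Jacobian quotient -/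

section Jacobian

variable {f : MvPolynomial (Fin 2) ℂ}

lemma isHomogeneous_jacobianIdeal (f : MvPolynomial (Fin 2) ℂ) :
    (jacobianIdeal f).IsHomogeneous (homogeneousSubmodule (Fin 3) ℂ) := by
  refine Ideal.homogeneous_span _ _ ?_
  rintro _ (rfl | rfl | rfl) <;> exact ⟨_, isHomogeneous_homogenization _⟩

/-- No prime of height at most one contains the Jacobian ideal of a square-free polynomial. -/
lemma two_le_height_of_mem_minimalPrimes (hf : Squarefree f) {Q : Ideal (MvPolynomial (Fin 3) ℂ)}
    (hQ : Q ∈ (jacobianIdeal f).minimalPrimes) : 2 ≤ Q.height := by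
  have hprime : Q.IsPrime := hQ.1.1
  have hhom := (isHomogeneous_jacobianIdeal f).of_mem_minimalPrimes hQ
  have hf0 : f ≠ 0 := hf.ne_zero
  have hmem : homogenization f ∈ Q := hQ.1.2 (Ideal.subset_span (by simp))
  by_contra! hlt
  have h1 : Q.height = 1 := by
    refine le_antisymm (Order.le_of_lt_add_one hlt) (Order.one_le_iff_ne_zero.mpr fun h0 => ?_)
    rw [Ideal.height_eq_zero_iff_eq_bot] at h0
    rw [h0, Ideal.mem_bot, homogenization_eq_zero_iff] at hmem
    exact hf0 hmem
  have hX : X 0 ∉ Q := fun h => by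
    rw [Ideal.eq_span_singleton_of_height_eq_one h1 h X_prime, Ideal.mem_span_singleton] at hmem
    exact not_X_zero_dvd_homogenization hf0 hmem
  obtain ⟨g, hg, hgp⟩ := hprime.exists_mem_prime_of_ne_bot (Ideal.ne_bot_of_height_eq_one h1)
  have hQg := Ideal.eq_span_singleton_of_height_eq_one h1 hg hgp
  -- By the Nullstellensatz, `X 0 ∉ Q` yields a zero off the line at infinity; scaled to `b 0 = 1`,
  -- it is a zero of the dehomogenized `g`, which is thus no unit.
  obtain ⟨b, hb, hb0⟩ : ∃ b ∈ zeroLocus ℂ Q, b 0 ≠ 0 := by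
    by_contra! hcon
    refine hX ?_
    rw [← IsPrime.vanishingIdeal_zeroLocus (K := ℂ) Q]
    intro b hb
    simpa using hcon b hb
  have hb' := smul_mem_zeroLocus hhom hb (b 0)⁻¹
  let φ : MvPolynomial (Fin 3) ℂ →ₐ[ℂ] MvPolynomial (Fin 2) ℂ := aeval (Fin.cons 1 X)
  have hdvd {p} (hp : homogenization p ∈ Q) : φ g ∣ p := by
    rw [hQg, Ideal.mem_span_singleton] at hp
    have := map_dvd φ hp
    rwa [show φ _ = p from aeval_cons_one_homogenization p] at this
  have hunit : ¬ IsUnit (φ g) := by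
    intro hu
    have hcomp : (aeval fun i : Fin 2 => (b 0)⁻¹ * b i.succ).comp φ =
        (aeval ((b 0)⁻¹ • b) : _ →ₐ[ℂ] ℂ) := by
      refine algHom_ext fun i => ?_
      refine Fin.cases ?_ (fun i => ?_) i <;> simp [φ, hb0]
    have h := hu.map (aeval fun i : Fin 2 => (b 0)⁻¹ * b i.succ : _ →ₐ[ℂ] ℂ)
    rw [← AlgHom.comp_apply, hcomp, hb' g hg] at h
    exact not_isUnit_zero h
  obtain ⟨q, hq, hqg⟩ := WfDvdMonoid.exists_irreducible_factor hunit
    (ne_zero_of_dvd_ne_zero hf0 (hdvd hmem))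
  refine not_forall_dvd_pderiv_of_squarefree hf hq (hqg.trans (hdvd hmem)) fun i => ?_
  refine hqg.trans (hdvd (hQ.1.2 (Ideal.subset_span ?_)))
  fin_cases i <;> simp

theorem ringKrullDim_quotient_jacobianIdeal (hf : Squarefree f)
    (hs : (singularPoints f).Nonempty) :
    ringKrullDim (MvPolynomial (Fin 3) ℂ ⧸ jacobianIdeal f) = 1 := by
  have hhom := isHomogeneous_jacobianIdeal f
  refine le_antisymm ?_ ?_
  -- A prime neither minimal nor maximal gives `Q < P < M` with `Q` of height at least 2, so `M`
  -- would have height at least 4.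
  · refine Ring.krullDimLE_iff.mp (Ideal.krullDimLE_one_quotient_iff.mpr fun P hP hle => ?_)
    rw [or_iff_not_imp_left]
    intro hmin
    by_contra hmax
    obtain ⟨Q, hQ, hQP⟩ := Ideal.exists_minimalPrimes_le hle
    have hQprime : Q.IsPrime := hQ.1.1
    obtain ⟨M, hM, hPM⟩ := Ideal.exists_le_maximal P hP.ne_top
    have h1 := Ideal.height_add_one_le_of_lt_of_isPrime
      (lt_of_le_of_ne hQP fun h => hmin (h ▸ hQ))
    have h2 := Ideal.height_add_one_le_of_lt_of_isPrime
      (lt_of_le_of_ne hPM fun h => hmax (h ▸ hM))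
    have h3 : M.height ≤ 3 := by
      rw [← WithBot.coe_le_coe]
      exact (Ideal.height_le_ringKrullDim_of_ne_top hM.ne_top).trans_eq
        ringKrullDim_mvPolynomial_fin_three
    have h4 : (2 : ℕ∞) + 1 + 1 ≤ 3 := calc
      (2 : ℕ∞) + 1 + 1 ≤ Q.height + 1 + 1 := by
        gcongr
        exact two_le_height_of_mem_minimalPrimes hf hQ
      _ ≤ P.height + 1 := by gcongr
      _ ≤ 3 := h2.trans h3
    exact absurd h4 (by decide)
  · obtain ⟨a, ha, ha1, ha2⟩ := hs
    let M : Ideal (MvPolynomial (Fin 3) ℂ) := 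
      RingHom.ker (eval (Fin.cons 1 a : Fin 3 → ℂ))
    have hMprime : M.IsPrime := RingHom.ker_isPrime _
    have hmem {p} (hp : eval a p = 0) : homogenization p ∈ M :=
      (eval_cons_one_homogenization p a).trans hp
    have hJM : jacobianIdeal f ≤ M := by
      refine Ideal.span_le.mpr ?_
      rintro _ (rfl | rfl | rfl)
      exacts [hmem ha, hmem ha1, hmem ha2]
    obtain ⟨Q, hQ, hQM⟩ := Ideal.exists_minimalPrimes_le hJM
    have hQirr := le_irrelevantIdeal (hhom.of_mem_minimalPrimes hQ) hQ.1.1.ne_top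
    by_contra hlt
    have hle : Ring.KrullDimLE 0 (MvPolynomial (Fin 3) ℂ ⧸ jacobianIdeal f) := by
      rw [Ring.krullDimLE_iff]
      have hlt' := not_le.mp hlt
      generalize ringKrullDim (MvPolynomial (Fin 3) ℂ ⧸ jacobianIdeal f) = d at hlt'
      induction d with
      | bot => exact bot_le
      | coe d => exact WithBot.coe_le_coe.mpr (Order.lt_one_iff.mp (WithBot.coe_lt_coe.mp hlt')).le
    have hQmax := Ideal.krullDimLE_zero_quotient_iff_forall_minimalPrimes_isMaximal.mp hle Q hQ
    -- In dimension 0 the minimal prime `Q` is maximal, so `Q = S₊`; but `x₀` takes the value 1 at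
    -- `(1, a)`.
    have hMirr : irrelevantIdeal ≤ M := by
      rwa [← hQmax.eq_of_le Ideal.IsPrime.ne_top' hQirr]
    have hX : X 0 ∈ M := hMirr (Ideal.subset_span (by simp))
    simp [M, RingHom.mem_ker] at hX

end Jacobian

end PlaneCurve

theorem mainTheorem5 (f : MvPolynomial (Fin 2) ℂ) :
    (Squarefree f → (PlaneCurve.singularPoints f).Nonempty →
      ringKrullDim (MvPolynomial (Fin 3) ℂ ⧸ PlaneCurve.jacobianIdeal f) = 1) ∧
    (ringKrullDim (MvPolynomial (Fin 3) ℂ ⧸ PlaneCurve.jacobianIdeal f) = 1 →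
      (PlaneCurve.IsCohenMacaulayRing (MvPolynomial (Fin 3) ℂ ⧸ PlaneCurve.jacobianIdeal f) ↔
        PlaneCurve.IsUnmixed (PlaneCurve.jacobianIdeal f)) ∧
      (PlaneCurve.IsUnmixed (PlaneCurve.jacobianIdeal f) ↔
        ¬ PlaneCurve.IsEmbeddedPrime (PlaneCurve.jacobianIdeal f)
          PlaneCurve.irrelevantIdeal)) := by
  refine ⟨PlaneCurve.ringKrullDim_quotient_jacobianIdeal, fun hdim => ?_⟩
  have hhom := PlaneCurve.isHomogeneous_jacobianIdeal f
  rw [PlaneCurve.isCohenMacaulayRing_quotient_iff hhom hdim, PlaneCurve.isUnmixed_iff hhom hdim,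
    PlaneCurve.isEmbeddedPrime_irrelevantIdeal_iff hhom hdim]
  exact ⟨Iff.rfl, Iff.rfl⟩
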